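/- **Setting.** Let $0<\alpha<2$, let $(S,\mu)$ be a measure space and let $M$ be a symmetric $\alpha$-stable random measure on $S$ with control measure $\mu$, on a probability space $(\Omega,P)$. That is, $M$ assigns to each measurable $A$ with $\mu(A)<\infty$ a real random variable $M(A)$ with $\mathbb E e^{i\theta M(A)}=e^{-\mu(A)|\theta|^\alpha}$ for $\theta\in\mathbb R$; $M(A_1),\dots,M(A_n)$ are independent when $A_1,\dots,A_n$ are disjoint; and $M(\bigcup_i A_i)=\sum_{i=1}^\infty M(A_i)$ almost surely (limit of the partial sums) whenever the $A_i$ are disjoint and $\mu(\bigcup_i A_i)<\infty$. For real $h\in L^\alpha(S,\mu)$, the stable integral $\int_S h\,dM$ is the limit in probability of $\sum_c c\,M(\{f_n=c\})$, where the $f_n$ are simple functions vanishing outside sets of finite measure with $f_n\to h$ in $L^\alpha(S,\mu)$; it is determined up to almost sure equality. For $\beta\in\mathbb C$ with $-1<\operatorname{Re}\beta<0$ put $$C_\beta=\frac{2^{\beta+1/2}\,\Gamma\left(\frac{\beta+1}{2}\right)}{\Gamma\left(-\frac{\beta}{2}\right)},$$ and for complex random variables put $\operatorname{cov}(X,Y)=\mathbb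 E\big[(X-\mathbb EX)\overline{(Y-\mathbb EY)}\big]$. **Theorem.** Let $\beta\in\mathbb C$ with $-\tfrac12<\operatorname{Re}\beta<0$ and let $\eta<1$. Let $h,g\in L^\alpha(S,\mu)$, $U=\int_S h\,dM$, $V=\int_S g\,dM$, and assume $$\int_S|h|^\alpha\,d\mu=1,\qquad \int_S|g|^\alpha\,d\mu=1,\qquad [U,V]_2:=\int_S|hg|^{\alpha/2}\,d\mu\le\eta .$$ Then $|U|^\beta|V|^{\overline\beta}$ is integrable, the integrand on the right below is Lebesgue integrable on $\mathbb R^2$, and $$\mathbb E\,|U|^\beta|V|^{\overline\beta}=\frac{C_\beta C_{\overline\beta}}{2\pi}\int_{\mathbb R^2}\frac{\mathbb E\,e^{ixU+iyV}}{|x|^{1+\beta}\,|y|^{1+\overline\beta}}\,dx\,dy .$$ Moreover $|U|^\beta$ and $|V|^\beta$ are integrable, and there is a constant $C(\eta)$, depending only on $\eta$, $\alpha$ and $\beta$ (and not on $S,\mu,\Omega,P,M,h,g$), such that $$\big|\operatorname{cov}(|U|^\beta,|V|^\beta)\big|\le C(\eta)\int_S|hg|^{\alpha/2}\,d\mu .$$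 -/

import Mathlib

open MeasureTheory ProbabilityTheory Filter Topology ComplexConjugate

universe u v

/-- `M` is a symmetric `α`-stable random measure on `S` with control measure `μ`, defined on the
probability space `(Ω, P)`: to each measurable set `A` with `μ A < ∞` it assigns a random variable
`M A` with characteristic function `θ ↦ exp (-μ(A) |θ|^α)` (scale parameter `μ(A)^(1/α)`); it is
independently scattered and almost surely `σ`-additive. The values of `M` on other sets are
irrelevant. The series in the `σ`-additivity is the limit of its partial sums (for `1 ≤ α` it need
not converge absolutely). -/
structure IsSymmStableRandomMeasure {S Ω : Type*} [MeasurableSpace S] [MeasurableSpace Ω]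
    (α : ℝ) (μ : Measure S) (P : Measure Ω) (M : Set S → Ω → ℝ) : Prop where
  measurable : ∀ A, MeasurableSet A → μ A < ⊤ → Measurable (M A)
  charFun_eq : ∀ A, MeasurableSet A → μ A < ⊤ → ∀ θ : ℝ,
    ∫ ω, Complex.exp (Complex.I * (θ * M A ω : ℝ)) ∂P
      = (Real.exp (-(μ.real A * |θ| ^ α)) : ℂ)
  indep : ∀ (n : ℕ) (A : Fin n → Set S), (∀ i, MeasurableSet (A i)) → (∀ i, μ (A i) < ⊤) →
    Pairwise (fun i j => Disjoint (A i) (A j)) → iIndepFun (fun i => M (A i)) P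
  sigma_additive : ∀ A : ℕ → Set S, (∀ i, MeasurableSet (A i)) →
    Pairwise (fun i j => Disjoint (A i) (A j)) → μ (⋃ i, A i) < ⊤ →
    ∀ᵐ ω ∂P, Tendsto (fun n => ∑ i ∈ Finset.range n, M (A i) ω) atTop (𝓝 (M (⋃ i, A i) ω))

/-- The integral `∑ c, c * M {f = c}` of a simple function (vanishing off a set of finite
measure; the value `c = 0` contributes nothing). -/
noncomputable def simpleStableIntegral {S Ω : Type*} [MeasurableSpace S]
    (M : Set S → Ω → ℝ) (f : SimpleFunc S ℝ) (ω : Ω) : ℝ :=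
  ∑ c ∈ f.range, c * M (f ⁻¹' {c}) ω

/-- `U` is (a version of) the stable integral `∫ h dM`: the limit in probability of the integrals
of simple functions which converge to `h` in `L^α(μ)`. -/
def IsStableIntegral {S Ω : Type*} [MeasurableSpace S] [MeasurableSpace Ω]
    (α : ℝ) (μ : Measure S) (P : Measure Ω) (M : Set S → Ω → ℝ) (h : S → ℝ) (U : Ω → ℝ) : Prop :=
  ∃ f : ℕ → SimpleFunc S ℝ, (∀ n, (f n).FinMeasSupp μ) ∧
    Tendsto (fun n => eLpNorm (fun s => f n s - h s) (ENNReal.ofReal α) μ) atTop (𝓝 0) ∧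
    TendstoInMeasure P (fun n => simpleStableIntegral M (f n)) atTop U

/-- The constant `C_β = 2^(β + 1/2) Γ((β + 1)/2) / Γ(-β/2)`. -/
noncomputable def fourierConst (β : ℂ) : ℂ :=
  2 ^ (β + 1 / 2) * Complex.Gamma ((β + 1) / 2) / Complex.Gamma (-β / 2)

/-- The random variable `|U|^β`, for a complex exponent `β`. -/
noncomputable def absCpow {Ω : Type*} (U : Ω → ℝ) (β : ℂ) (ω : Ω) : ℂ :=
  ((|U ω| : ℝ) : ℂ) ^ β

/-- The covariance `E[(X - E X) conj (Y - E Y)]` of complex random variables. -/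
noncomputable def complexCov {Ω : Type*} [MeasurableSpace Ω] (P : Measure Ω) (X Y : Ω → ℂ) : ℂ :=
  ∫ ω, (X ω - ∫ ω', X ω' ∂P) * conj (Y ω - ∫ ω', Y ω' ∂P) ∂P

/-- The integrand `E exp(i(xU + yV)) / (|x|^(1+β) |y|^(1+conj β))` at the point `p = (x, y)`. -/
noncomputable def charIntegrand {Ω : Type*} [MeasurableSpace Ω] (P : Measure Ω) (U V : Ω → ℝ)
    (β : ℂ) (p : ℝ × ℝ) : ℂ :=
  (∫ ω, Complex.exp (Complex.I * (p.1 * U ω + p.2 * V ω : ℝ)) ∂P) /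
    (((|p.1| : ℝ) : ℂ) ^ (1 + β) * ((|p.2| : ℝ) : ℂ) ^ (1 + conj β))

/-! The joint characteristic function of `(U, V)` at `(x, y)` is `exp (-N(x, y))` with `N(x, y) = ∫
|x h + y g| ^ α dμ`. This holds for simple integrands by independent scattering and passes to the
limit.

Moment formula: the power `|x| ^ (-1 - β)` is a mixture of Gaussians `exp (-t x²)` over `t > 0`. The
Fourier transform of each Gaussian is again Gaussian, and integrating it over `t` gives a multiple
of `|u| ^ β`. Applying this in both variables and exchanging integrals
(`integrable_and_integral_absCpow_mul`) turns the moment into an absolutely convergent integral of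
the characteristic function; no distribution theory is needed.

Covariance bound: write `κ = ∫ |h g| ^ (α/2) dμ`. Subadditivity of `|·| ^ (α/2)` yields `|N(x, y) -
|x| ^ α - |y| ^ α| ≤ 2 |x y| ^ (α/2) κ` and hence `N(x, y) ≥ (1 - η)(|x| ^ α + |y| ^ α)`. The lower
bound makes the integrand integrable. The product of the means is the same moment formula for
independent copies of `U` and `V`, so the covariance is an integral of the difference of two
characteristic functions. That difference is at most `2 |x y| ^ (α/2) κ exp (-(1 - η)(|x| ^ α + |y|
^ α))`, which gives a bound linear in `κ` (`norm_integral_sub_charIntegrand_le`). -/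

/-! ### Elementary inequalities for `α`-th powers. -/

theorem abs_rpow_add_sub_le {α : ℝ} (hα₀ : 0 < α) (hα₂ : α ≤ 2) (a b : ℝ) :
    |(|a + b| ^ α - |a| ^ α - |b| ^ α)| ≤ 2 * |a * b| ^ (α / 2) := by
  have hp : 0 ≤ α / 2 := by positivity
  have hp1 : α / 2 ≤ 1 := by linarith
  have sub : ∀ x y : ℝ, |x + y| ^ (α / 2) ≤ |x| ^ (α / 2) + |y| ^ (α / 2) := fun x y =>
    (Real.rpow_le_rpow (abs_nonneg _) (abs_add_le x y) hp).trans
      (Real.rpow_add_le_add_rpow (abs_nonneg _) (abs_nonneg _) hp hp1)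
  have sq : ∀ x : ℝ, |x| ^ α = (|x| ^ (α / 2)) ^ 2 := fun x => by
    rw [← Real.rpow_natCast, ← Real.rpow_mul (abs_nonneg _)]; norm_num
  -- With `A`, `B`, `D` the `α/2`-th powers of `|a|`, `|b|`, `|a + b|`, the three bounds say `|A -
  -- B| ≤ D ≤ A + B`; squaring gives `|D² - A² - B²| ≤ 2AB`.
  have h1 := sub a b
  have h2 := sub (a + b) (-b)
  have h3 := sub (a + b) (-a)
  rw [abs_neg] at h2 h3
  simp only [add_neg_cancel_right] at h2
  rw [show a + b + -a = b by ring] at h3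
  rw [sq, sq, sq, abs_mul, Real.mul_rpow (abs_nonneg _) (abs_nonneg _)]
  have hA : 0 ≤ |a| ^ (α / 2) := by positivity
  have hB : 0 ≤ |b| ^ (α / 2) := by positivity
  have hD : 0 ≤ |a + b| ^ (α / 2) := by positivity
  rw [abs_le]
  constructor <;> nlinarith

theorem abs_mul_rpow_half_le {α : ℝ} (a b : ℝ) :
    2 * |a * b| ^ (α / 2) ≤ |a| ^ α + |b| ^ α := by
  have sq : ∀ x : ℝ, |x| ^ α = (|x| ^ (α / 2)) ^ 2 := fun x => by
    rw [← Real.rpow_natCast, ← Real.rpow_mul (abs_nonneg _)]; norm_num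
  rw [sq, sq, abs_mul, Real.mul_rpow (abs_nonneg _) (abs_nonneg _)]
  nlinarith [sq_nonneg (|a| ^ (α / 2) - |b| ^ (α / 2))]

theorem abs_rpow_add_le_two_mul {α : ℝ} (hα₀ : 0 < α) (hα₂ : α ≤ 2) (a b : ℝ) :
    |a + b| ^ α ≤ 2 * (|a| ^ α + |b| ^ α) := by
  have h1 := (abs_le.1 (abs_rpow_add_sub_le hα₀ hα₂ a b)).2
  have h2 := abs_mul_rpow_half_le (α := α) a b
  linarith

/-- The cross term in `abs_rpow_add_sub_le` is split by Young's inequality with weight `ε`. This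
gives continuity of `∫ |f| ^ α` uniformly in `0 < α ≤ 2`, with no case split at `α = 1`. -/
theorem abs_rpow_sub_rpow_le {α ε : ℝ} (hα₀ : 0 < α) (hα₂ : α ≤ 2) (hε : 0 < ε) (a b : ℝ) :
    |(|a| ^ α - |b| ^ α)| ≤ (1 + 1 / ε) * |a - b| ^ α + ε * |b| ^ α := by
  have sq : ∀ x : ℝ, |x| ^ α = (|x| ^ (α / 2)) ^ 2 := fun x => by
    rw [← Real.rpow_natCast, ← Real.rpow_mul (abs_nonneg _)]; norm_num
  have h := abs_rpow_add_sub_le hα₀ hα₂ b (a - b)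
  rw [add_sub_cancel, abs_mul, Real.mul_rpow (abs_nonneg _) (abs_nonneg _)] at h
  rw [sq a, sq b, sq (a - b)] at *
  set B := |b| ^ (α / 2)
  set D := |a - b| ^ (α / 2)
  have key : 2 * (B * D) ≤ ε * B ^ 2 + 1 / ε * D ^ 2 := by
    have : 0 ≤ (ε * B - D) ^ 2 / ε := by positivity
    have e : (ε * B - D) ^ 2 / ε = ε * B ^ 2 + 1 / ε * D ^ 2 - 2 * (B * D) := by
      field_simp; ring
    linarith
  rw [abs_le] at h ⊢
  constructor <;> nlinarith [sq_nonneg D]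

/-! ### Continuity of `∫ |f| ^ α` under convergence in `L^α`. -/

section Integrals

variable {S : Type*} [MeasurableSpace S] {μ : Measure S} {α : ℝ}

theorem MeasureTheory.MemLp.integrable_abs_rpow (hα₀ : 0 < α) {f : S → ℝ}
    (hf : MemLp f (ENNReal.ofReal α) μ) : Integrable (fun s => |f s| ^ α) μ := by
  have := hf.integrable_norm_rpow (by simpa using hα₀) ENNReal.ofReal_ne_top
  simpa [ENNReal.toReal_ofReal hα₀.le] using this

theorem integrable_abs_mul_rpow_half {f g : S → ℝ} (hα₀ : 0 < α)
    (hf : MemLp f (ENNReal.ofReal α) μ) (hg : MemLp g (ENNReal.ofReal α) μ) :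
    Integrable (fun s => |f s * g s| ^ (α / 2)) μ := by
  refine ((hf.integrable_abs_rpow hα₀).add (hg.integrable_abs_rpow hα₀)).mono' ?_ ?_
  · have h1 := hf.1.aemeasurable
    have h2 := hg.1.aemeasurable
    exact AEMeasurable.aestronglyMeasurable (by fun_prop)
  · refine .of_forall fun s => ?_
    have h2 := abs_mul_rpow_half_le (α := α) (f s) (g s)
    have h3 : 0 ≤ |f s * g s| ^ (α / 2) := by positivity
    rw [Real.norm_of_nonneg h3, Pi.add_apply]
    linarith

theorem tendsto_integral_abs_sub_rpow (hα₀ : 0 < α) {f : ℕ → S → ℝ} {h : S → ℝ}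
    (hf : ∀ n, MemLp (f n) (ENNReal.ofReal α) μ) (hh : MemLp h (ENNReal.ofReal α) μ)
    (hlim : Tendsto (fun n => eLpNorm (fun s => f n s - h s) (ENNReal.ofReal α) μ) atTop (𝓝 0)) :
    Tendsto (fun n => ∫ s, |f n s - h s| ^ α ∂μ) atTop (𝓝 0) := by
  have e : ∀ n, ∫ s, |f n s - h s| ^ α ∂μ
      = (eLpNorm (fun s => f n s - h s) (ENNReal.ofReal α) μ).toReal ^ α := fun n => by
    have hm : MemLp (fun s => f n s - h s) (ENNReal.ofReal α) μ := (hf n).sub hh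
    have h0 : 0 ≤ ∫ s, |f n s - h s| ^ α ∂μ := integral_nonneg fun s => by positivity
    rw [hm.eLpNorm_eq_integral_rpow_norm (by simpa using hα₀) ENNReal.ofReal_ne_top,
      ENNReal.toReal_ofReal hα₀.le]
    simp only [Real.norm_eq_abs]
    rw [ENNReal.toReal_ofReal (by positivity), Real.rpow_inv_rpow h0 hα₀.ne']
  simp only [e]
  have h1 := (ENNReal.tendsto_toReal ENNReal.zero_ne_top).comp hlim
  have h2 := h1.rpow_const (p := α) (Or.inr hα₀.le)
  simpa [Real.zero_rpow hα₀.ne'] using h2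

theorem tendsto_integral_abs_rpow_linear_comb (hα₀ : 0 < α) (hα₂ : α ≤ 2)
    {f k : ℕ → S → ℝ} {h g : S → ℝ}
    (hf : ∀ n, MemLp (f n) (ENNReal.ofReal α) μ) (hh : MemLp h (ENNReal.ofReal α) μ)
    (hk : ∀ n, MemLp (k n) (ENNReal.ofReal α) μ) (hg : MemLp g (ENNReal.ofReal α) μ)
    (hfh : Tendsto (fun n => eLpNorm (fun s => f n s - h s) (ENNReal.ofReal α) μ) atTop (𝓝 0))
    (hkg : Tendsto (fun n => eLpNorm (fun s => k n s - g s) (ENNReal.ofReal α) μ) atTop (𝓝 0))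
    (x y : ℝ) :
    Tendsto (fun n => ∫ s, |x * f n s + y * k n s| ^ α ∂μ) atTop
      (𝓝 (∫ s, |x * h s + y * g s| ^ α ∂μ)) := by
  have hH : MemLp (fun s => x * h s + y * g s) (ENNReal.ofReal α) μ :=
    (hh.const_mul x).add (hg.const_mul y)
  have hF : ∀ n, MemLp (fun s => x * f n s + y * k n s) (ENNReal.ofReal α) μ := fun n =>
    ((hf n).const_mul x).add ((hk n).const_mul y)
  set J := ∫ s, |x * h s + y * g s| ^ α ∂μ with hJ
  have hJ0 : 0 ≤ J := integral_nonneg fun s => by positivity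
  let d : ℕ → ℝ := fun n => 2 * (|x| ^ α * ∫ s, |f n s - h s| ^ α ∂μ)
    + 2 * (|y| ^ α * ∫ s, |k n s - g s| ^ α ∂μ)
  have hd : Tendsto d atTop (𝓝 0) := by
    have h1 := ((tendsto_integral_abs_sub_rpow hα₀ hf hh hfh).const_mul (|x| ^ α)).const_mul 2
    have h2 := ((tendsto_integral_abs_sub_rpow hα₀ hk hg hkg).const_mul (|y| ^ α)).const_mul 2
    simpa using h1.add h2
  have bound : ∀ ε : ℝ, 0 < ε → ∀ n,
      |∫ s, |x * f n s + y * k n s| ^ α ∂μ - J| ≤ (1 + 1 / ε) * d n + ε * J := by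
    intro ε hε n
    have i1 := (hF n).integrable_abs_rpow hα₀
    have i2 := hH.integrable_abs_rpow hα₀
    have i3 : Integrable (fun s => |f n s - h s| ^ α) μ :=
      MemLp.integrable_abs_rpow hα₀ ((hf n).sub hh)
    have i4 : Integrable (fun s => |k n s - g s| ^ α) μ :=
      MemLp.integrable_abs_rpow hα₀ ((hk n).sub hg)
    rw [hJ, ← integral_sub i1 i2]
    have i5 : Integrable (fun s => (1 + 1 / ε) * (2 * (|x| ^ α * |f n s - h s| ^ α)
        + 2 * (|y| ^ α * |k n s - g s| ^ α)) + ε * |x * h s + y * g s| ^ α) μ :=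
      ((((i3.const_mul _).const_mul _).add ((i4.const_mul _).const_mul _)).const_mul _).add
        (i2.const_mul _)
    refine (abs_integral_le_integral_abs).trans ((integral_mono (i1.sub i2).abs i5 ?_).trans ?_)
    · intro s
      refine (abs_rpow_sub_rpow_le hα₀ hα₂ hε _ _).trans ?_
      have e : x * f n s + y * k n s - (x * h s + y * g s)
          = x * (f n s - h s) + y * (k n s - g s) := by ring
      rw [e]
      have := abs_rpow_add_le_two_mul hα₀ hα₂ (x * (f n s - h s)) (y * (k n s - g s))
      rw [abs_mul, abs_mul, Real.mul_rpow (abs_nonneg _) (abs_nonneg _),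
        Real.mul_rpow (abs_nonneg _) (abs_nonneg _)] at this
      dsimp only
      gcongr
      linarith
    · rw [integral_add, integral_const_mul, integral_const_mul, integral_add, integral_const_mul,
        integral_const_mul, integral_const_mul, integral_const_mul]
      · exact (i3.const_mul _).const_mul _
      · exact (i4.const_mul _).const_mul _
      · exact ((((i3.const_mul _).const_mul _).add ((i4.const_mul _).const_mul _)).const_mul _)
      · exact i2.const_mul _
  rw [Metric.tendsto_atTop]
  intro r hr
  -- `ε` makes the fixed term `ε * J` smaller than `r / 2`; only then is `n` chosen to make the term
  -- with `d n` small.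
  set ε := r / (2 * (J + 1)) with hε
  have hε0 : 0 < ε := by positivity
  have hεJ : ε * J < r / 2 := by
    have : ε * (J + 1) = r / 2 := by rw [hε]; field_simp
    nlinarith
  have h1 : Tendsto (fun n => (1 + 1 / ε) * d n) atTop (𝓝 0) := by
    simpa using hd.const_mul (1 + 1 / ε)
  obtain ⟨N, hN⟩ := eventually_atTop.1 (h1.eventually (gt_mem_nhds (half_pos hr)))
  exact ⟨N, fun n hn => by
    rw [Real.dist_eq]
    linarith [bound ε hε0 n, hN n hn]⟩

end Integrals

/-! ### Joint characteristic function of stable integrals. -/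

section RandomMeasure

variable {S Ω : Type*} [MeasurableSpace S] [MeasurableSpace Ω] {α : ℝ} {μ : Measure S}
  {P : Measure Ω} {M : Set S → Ω → ℝ}

namespace IsSymmStableRandomMeasure

theorem empty_ae_eq_zero (hM : IsSymmStableRandomMeasure α μ P M) : M ∅ =ᵐ[P] 0 := by
  have h := hM.sigma_additive (fun _ => ∅) (fun _ => .empty) (fun _ _ _ => by simp) (by simp)
  filter_upwards [h] with ω hω
  simp only [Set.iUnion_empty, Finset.sum_const, Finset.card_range, nsmul_eq_mul] at hω
  -- The partial sums `n * M ∅` converge, so their consecutive differences, all equal to `M ∅`, tend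
  -- to `0`.
  have h1 := hω.comp (tendsto_add_atTop_nat 1)
  have h2 := h1.sub hω
  simpa [Function.comp_def, add_mul] using h2

theorem finset_biUnion (hM : IsSymmStableRandomMeasure α μ P M) {ι : Type*} [DecidableEq ι]
    (s : Finset ι) (A : ι → Set S) (hA : ∀ i ∈ s, MeasurableSet (A i)) (hfin : ∀ i ∈ s, μ (A i) < ⊤)
    (hdisj : (s : Set ι).PairwiseDisjoint A) :
    M (⋃ i ∈ s, A i) =ᵐ[P] fun ω => ∑ i ∈ s, M (A i) ω := by
  classical
  let e := s.equivFin
  let B : ℕ → Set S := fun n => if h : n < s.card then A (e.symm ⟨n, h⟩) else ∅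
  have hB : ∀ n, MeasurableSet (B n) := fun n => by
    by_cases h : n < s.card
    · simp only [B, h, dif_pos]; exact hA _ (e.symm ⟨n, h⟩).2
    · simp [B, h]
  have hU : ⋃ n, B n = ⋃ i ∈ s, A i := by
    ext z
    simp only [Set.mem_iUnion]
    constructor
    · rintro ⟨n, hn⟩
      by_cases h : n < s.card
      · simp only [B, h, dif_pos] at hn
        exact ⟨_, (e.symm ⟨n, h⟩).2, hn⟩
      · simp [B, h] at hn
    · rintro ⟨i, hi, hz⟩
      exact ⟨e ⟨i, hi⟩, by simpa [B] using hz⟩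
  have hd : Pairwise (fun i j => Disjoint (B i) (B j)) := by
    intro i j hij
    by_cases h : i < s.card
    · by_cases h' : j < s.card
      · simp only [B, h, h', dif_pos]
        refine hdisj (e.symm ⟨i, h⟩).2 (e.symm ⟨j, h'⟩).2 fun hh => hij ?_
        have := e.symm.injective (Subtype.ext hh)
        simpa using this
      · simp [B, h']
    · simp [B, h]
  have hf : μ (⋃ n, B n) < ⊤ := by
    rw [hU]; exact (measure_biUnion_lt_top s.finite_toSet hfin)
  filter_upwards [hM.sigma_additive B hB hd hf, hM.empty_ae_eq_zero] with ω h1 h2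
  rw [hU] at h1
  have h3 : ∀ n, s.card ≤ n → ∑ i ∈ Finset.range n, M (B i) ω = ∑ i ∈ s, M (A i) ω := by
    intro n hn
    rw [← Finset.sum_subset (Finset.range_subset_range.2 hn), Finset.sum_range,
      ← Finset.sum_coe_sort s, ← e.symm.sum_comp]
    · refine Finset.sum_congr rfl fun i _ => ?_
      simp [B]
    · intro i _ hi
      have : ¬ i < s.card := by simpa using hi
      simpa [B, this] using h2
  exact tendsto_nhds_unique h1 (tendsto_atTop_of_eventually_const h3)

/-- Lets two simple functions be integrated over the common partition given by their pair. The level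
set of the value `0` may have infinite measure, where `M` is uncontrolled, but its coefficient
vanishes. -/
theorem simpleStableIntegral_map (hM : IsSymmStableRandomMeasure α μ P M) {γ : Type*}
    [DecidableEq γ] (p : SimpleFunc S γ) (k : γ → ℝ) (hp : (p.map k).FinMeasSupp μ) :
    simpleStableIntegral M (p.map k) =ᵐ[P]
      fun ω => ∑ q ∈ p.range, k q * M (p ⁻¹' {q}) ω := by
  classical
  have hfin : ∀ q, k q ≠ 0 → μ (p ⁻¹' {q}) < ⊤ := fun q hq => by
    refine (measure_mono ?_).trans_lt (SimpleFunc.finMeasSupp_iff.1 hp (k q) hq)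
    intro s hs
    simp only [Set.mem_preimage, Set.mem_singleton_iff] at hs ⊢
    simp [hs]
  have key : ∀ c ∈ (p.map k).range, c ≠ 0 →
      M ((p.map k) ⁻¹' {c}) =ᵐ[P] fun ω => ∑ q ∈ p.range with k q = c, M (p ⁻¹' {q}) ω := by
    intro c _ hc
    have e : (p.map k) ⁻¹' {c} = ⋃ q ∈ p.range.filter (fun q => k q = c), p ⁻¹' {q} := by
      ext s; simp
    rw [e]
    refine hM.finset_biUnion _ _ (fun q _ => p.measurableSet_preimage _) (fun q hq => ?_) ?_
    · refine hfin q ?_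
      rw [(Finset.mem_filter.1 hq).2]; exact hc
    · intro q _ q' _ hqq
      exact Disjoint.preimage _ (by simpa using hqq)
  have key' : ∀ᵐ ω ∂P, ∀ c ∈ (p.map k).range, c ≠ 0 →
      M ((p.map k) ⁻¹' {c}) ω = ∑ q ∈ p.range with k q = c, M (p ⁻¹' {q}) ω := by
    refine (p.map k).range.eventually_all.2 fun c hc => ?_
    by_cases h : c = 0
    · simp [h]
    · filter_upwards [key c hc h] with ω hω _ using hω
  filter_upwards [key'] with ω hω
  rw [simpleStableIntegral, ← Finset.sum_fiberwise_of_maps_to (t := (p.map k).range) (g := k)]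
  · refine Finset.sum_congr rfl fun c hc => ?_
    by_cases h : c = 0
    · subst h
      rw [zero_mul, Finset.sum_eq_zero]
      intro q hq
      rw [(Finset.mem_filter.1 hq).2, zero_mul]
    · rw [hω c hc h, Finset.mul_sum]
      refine Finset.sum_congr rfl fun q hq => ?_
      rw [(Finset.mem_filter.1 hq).2]
  · intro q hq
    rw [SimpleFunc.mem_range] at hq ⊢
    obtain ⟨s, rfl⟩ := hq
    exact ⟨s, rfl⟩

/-- The characteristic function of a linear combination of values on disjoint sets. -/
theorem integral_exp_sum (hM : IsSymmStableRandomMeasure α μ P M) (hα₀ : 0 < α)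
    [IsProbabilityMeasure P] {γ : Type*} [DecidableEq γ]
    (p : SimpleFunc S γ) (c : γ → ℝ) (hp : (p.map c).FinMeasSupp μ) :
    ∫ ω, Complex.exp (Complex.I * (∑ q ∈ p.range, c q * M (p ⁻¹' {q}) ω : ℝ)) ∂P
      = (Real.exp (-∫ s, |c (p s)| ^ α ∂μ) : ℂ) := by
  classical
  -- Only nonzero coefficients are kept: their level sets have finite measure, as independence and
  -- the characteristic function of `M` require.
  set T := p.range.filter (fun q => c q ≠ 0) with hT
  have hfin : ∀ q, c q ≠ 0 → μ (p ⁻¹' {q}) < ⊤ := fun q hq => by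
    refine (measure_mono ?_).trans_lt (SimpleFunc.finMeasSupp_iff.1 hp (c q) hq)
    intro s hs
    simp only [Set.mem_preimage, Set.mem_singleton_iff] at hs ⊢
    simp [hs]
  let e := T.equivFin
  let A : Fin T.card → Set S := fun i => p ⁻¹' {(e.symm i : γ)}
  have hc0 : ∀ i, c (e.symm i : γ) ≠ 0 := fun i => (Finset.mem_filter.1 (e.symm i).2).2
  have hAm : ∀ i, MeasurableSet (A i) := fun i => p.measurableSet_preimage _
  have hAf : ∀ i, μ (A i) < ⊤ := fun i => hfin _ (hc0 i)
  have hind := hM.indep _ A hAm hAf (by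
    intro i j hij
    refine Disjoint.preimage _ (Set.disjoint_singleton.2 fun h => hij ?_)
    exact e.symm.injective (Subtype.ext h))
  have hsum : ∀ ω, ∑ q ∈ p.range, c q * M (p ⁻¹' {q}) ω
      = ∑ i, c (e.symm i : γ) * M (A i) ω := by
    intro ω
    rw [← Finset.sum_subset (Finset.filter_subset (fun q => c q ≠ 0) p.range), ← hT,
      ← Finset.sum_coe_sort T, ← e.symm.sum_comp]
    intro q hq hq'
    have : c q = 0 := by
      by_contra h
      exact hq' (Finset.mem_filter.2 ⟨hq, h⟩)
    simp [this]
  have hint : ∫ s, |c (p s)| ^ α ∂μ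
      = ∑ i, μ.real (A i) * |c (e.symm i : γ)| ^ α := by
    have e1 : ∀ s, |c (p s)| ^ α
        = ∑ i, (A i).indicator (fun _ => |c (e.symm i : γ)| ^ α) s := by
      intro s
      by_cases h : c (p s) = 0
      · rw [Finset.sum_eq_zero, h, abs_zero, Real.zero_rpow hα₀.ne']
        intro i _
        refine Set.indicator_of_notMem (fun hs => hc0 i ?_) _
        have : p s = e.symm i := hs
        rw [← this, h]
      · have hmem : p s ∈ T := Finset.mem_filter.2 ⟨p.mem_range_self s, h⟩
        rw [Finset.sum_eq_single (e ⟨p s, hmem⟩)]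
        · rw [Set.indicator_of_mem] <;> simp [A]
        · intro i _ hi
          refine Set.indicator_of_notMem (fun hs => hi ?_) _
          have : p s = e.symm i := hs
          exact e.symm_apply_eq.1 (Subtype.ext this.symm)
        · simp
    simp_rw [e1]
    rw [integral_finsetSum]
    · refine Finset.sum_congr rfl fun i _ => ?_
      rw [integral_indicator_const _ (hAm i), smul_eq_mul]
    · intro i _
      exact (integrable_indicator_iff (hAm i)).2 (integrableOn_const (hAf i).ne)
  have hE : ∀ ω, Complex.exp (Complex.I * (∑ q ∈ p.range, c q * M (p ⁻¹' {q}) ω : ℝ))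
      = ∏ i, Complex.exp (Complex.I * (c (e.symm i : γ) * M (A i) ω : ℝ)) := by
    intro ω
    rw [hsum, ← Complex.exp_sum, Complex.ofReal_sum, Finset.mul_sum]
  simp_rw [hE]
  rw [hind.integral_fun_prod_comp
    (f := fun i z => Complex.exp (Complex.I * (c (e.symm i : γ) * z : ℝ)))
    (fun i => (hM.measurable _ (hAm i) (hAf i)).aemeasurable)
    (fun i => by fun_prop), hint]
  simp_rw [hM.charFun_eq _ (hAm _) (hAf _)]
  rw [← Finset.sum_neg_distrib, Real.exp_sum, Complex.ofReal_prod]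

theorem integral_exp_simpleStableIntegral (hM : IsSymmStableRandomMeasure α μ P M) (hα₀ : 0 < α)
    [IsProbabilityMeasure P] (f k : SimpleFunc S ℝ) (hf : f.FinMeasSupp μ) (hk : k.FinMeasSupp μ)
    (x y : ℝ) :
    ∫ ω, Complex.exp (Complex.I *
        (x * simpleStableIntegral M f ω + y * simpleStableIntegral M k ω : ℝ)) ∂P
      = (Real.exp (-∫ s, |x * f s + y * k s| ^ α ∂μ) : ℂ) := by
  classical
  let p := f.pair k
  have h1 := hM.simpleStableIntegral_map p Prod.fst (by simpa [p] using hf)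
  have h2 := hM.simpleStableIntegral_map p Prod.snd (by simpa [p] using hk)
  rw [show p.map Prod.fst = f from SimpleFunc.map_fst_pair f k] at h1
  rw [show p.map Prod.snd = k from SimpleFunc.map_snd_pair f k] at h2
  have h3 := hM.integral_exp_sum hα₀ p (fun q => x * q.1 + y * q.2)
    ((hf.pair hk).map (by simp))
  rw [show (∫ s, |x * f s + y * k s| ^ α ∂μ) = ∫ s, |x * (p s).1 + y * (p s).2| ^ α ∂μ from rfl,
    ← h3]
  refine integral_congr_ae ?_
  filter_upwards [h1, h2] with ω e1 e2
  rw [e1, e2, Finset.mul_sum, Finset.mul_sum, ← Finset.sum_add_distrib]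
  congr 3
  refine Finset.sum_congr rfl fun q _ => by ring

theorem aemeasurable_simpleStableIntegral (hM : IsSymmStableRandomMeasure α μ P M)
    (f : SimpleFunc S ℝ) (hf : f.FinMeasSupp μ) : AEMeasurable (simpleStableIntegral M f) P := by
  unfold simpleStableIntegral
  refine Finset.aemeasurable_fun_sum _ fun c _ => ?_
  by_cases h : c = 0
  · simp [h]
  · exact ((hM.measurable _ (f.measurableSet_preimage _)
      (SimpleFunc.finMeasSupp_iff.1 hf c h)).const_mul c).aemeasurable

theorem aemeasurable_of_isStableIntegral (hM : IsSymmStableRandomMeasure α μ P M) {h : S → ℝ}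
    {U : Ω → ℝ} (hU : IsStableIntegral α μ P M h U) : AEMeasurable U P := by
  obtain ⟨f, hf, -, hlim⟩ := hU
  exact hlim.aemeasurable fun n => hM.aemeasurable_simpleStableIntegral _ (hf n)

/-- The joint characteristic function of two stable integrals. -/
theorem integral_exp_stableIntegral (hM : IsSymmStableRandomMeasure α μ P M) (hα₀ : 0 < α)
    (hα₂ : α ≤ 2) [IsProbabilityMeasure P] {h g : S → ℝ} {U V : Ω → ℝ}
    (hh : MemLp h (ENNReal.ofReal α) μ) (hg : MemLp g (ENNReal.ofReal α) μ)
    (hU : IsStableIntegral α μ P M h U) (hV : IsStableIntegral α μ P M g V) (x y : ℝ) :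
    ∫ ω, Complex.exp (Complex.I * (x * U ω + y * V ω : ℝ)) ∂P
      = (Real.exp (-∫ s, |x * h s + y * g s| ^ α ∂μ) : ℂ) := by
  obtain ⟨f, hf, hfh, hfU⟩ := hU
  obtain ⟨k, hk, hkg, hkV⟩ := hV
  obtain ⟨n₁, hn₁, hU'⟩ := hfU.exists_seq_tendsto_ae
  -- A subsequence of the first subsequence, so that both integrals converge almost surely along the
  -- same indices.
  obtain ⟨n₂, hn₂, hV'⟩ := (hkV.comp hn₁.tendsto_atTop).exists_seq_tendsto_ae
  have hm : ∀ f : SimpleFunc S ℝ, f.FinMeasSupp μ → MemLp f (ENNReal.ofReal α) μ := fun f hf =>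
    SimpleFunc.memLp_of_finite_measure_preimage _ (SimpleFunc.finMeasSupp_iff.1 hf)
  have hn : Tendsto (fun i => n₁ (n₂ i)) atTop atTop := hn₁.tendsto_atTop.comp hn₂.tendsto_atTop
  have hlim := (tendsto_integral_abs_rpow_linear_comb hα₀ hα₂ (fun n => hm _ (hf n)) hh
    (fun n => hm _ (hk n)) hg hfh hkg x y).comp hn
  have hlim2 : Tendsto (fun i => ∫ ω, Complex.exp (Complex.I *
      (x * simpleStableIntegral M (f (n₁ (n₂ i))) ω
        + y * simpleStableIntegral M (k (n₁ (n₂ i))) ω : ℝ)) ∂P) atTop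
      (𝓝 (∫ ω, Complex.exp (Complex.I * (x * U ω + y * V ω : ℝ)) ∂P)) := by
    refine tendsto_integral_of_dominated_convergence (fun _ => 1) (fun i => ?_)
      (integrable_const _) (fun i => .of_forall fun ω => ?_) ?_
    · have a1 := hM.aemeasurable_simpleStableIntegral _ (hf (n₁ (n₂ i)))
      have a2 := hM.aemeasurable_simpleStableIntegral _ (hk (n₁ (n₂ i)))
      exact AEMeasurable.aestronglyMeasurable (by fun_prop)
    · rw [mul_comm, Complex.norm_exp_ofReal_mul_I]
    · filter_upwards [hU', hV'] with ω h1 h2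
      have h1' := h1.comp hn₂.tendsto_atTop
      have h3 := (h1'.const_mul x).add (h2.const_mul y)
      exact (((Complex.continuous_ofReal.tendsto _).comp h3).const_mul Complex.I).cexp
  refine tendsto_nhds_unique hlim2 ?_
  simp_rw [hM.integral_exp_simpleStableIntegral hα₀ _ _ (hf _) (hk _)]
  exact (Complex.continuous_ofReal.tendsto _).comp
    ((Real.continuous_exp.tendsto _).comp hlim.neg)

end IsSymmStableRandomMeasure

end RandomMeasure

/-! ### Powers as mixtures of Gaussians. -/

/-- The subordination kernel `t ^ ((β - 1) / 2) * exp (-t x²)`, whose integral over `t > 0` is a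
multiple of `|x| ^ (-1 - β)`. -/
noncomputable def gaussKernel (β : ℂ) (t x : ℝ) : ℂ :=
  (t : ℂ) ^ ((1 + β) / 2 - 1) * Complex.exp (-((x ^ 2 : ℝ) * t))

/-- The Fourier transform of `gaussKernel β t`. -/
noncomputable def gaussKernelFourier (β : ℂ) (t u : ℝ) : ℂ :=
  (√Real.pi : ℝ) * ((t : ℂ) ^ (β / 2 - 1) * Complex.exp (-((u ^ 2 / 4 : ℝ) * (t⁻¹ : ℝ))))

@[fun_prop]
theorem measurable_gaussKernel {X : Type*} [MeasurableSpace X] (β : ℂ) {a b : X → ℝ}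
    (ha : Measurable a) (hb : Measurable b) : Measurable fun z => gaussKernel β (a z) (b z) := by
  unfold gaussKernel
  fun_prop

@[fun_prop]
theorem aemeasurable_gaussKernelFourier {X : Type*} [MeasurableSpace X] {m : Measure X} (β : ℂ)
    {a b : X → ℝ} (ha : AEMeasurable a m) (hb : AEMeasurable b m) :
    AEMeasurable (fun z => gaussKernelFourier β (a z) (b z)) m := by
  unfold gaussKernelFourier
  fun_prop

theorem norm_gaussKernel (β : ℂ) {t : ℝ} (ht : 0 < t) (x : ℝ) :
    ‖gaussKernel β t x‖ = t ^ ((1 + β.re) / 2 - 1) * Real.exp (-(x ^ 2 * t)) := by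
  rw [gaussKernel, norm_mul, Complex.norm_cpow_eq_rpow_re_of_pos ht, Complex.norm_exp]
  congr 2
  · simp
  · norm_cast

theorem integrable_gaussKernel_left {β : ℂ} (hβ : -1 < β.re) {x : ℝ} (hx : x ≠ 0) :
    Integrable (fun t => gaussKernel β t x) (volume.restrict (Set.Ioi 0)) := by
  have h := integrableOn_rpow_mul_exp_neg_mul_rpow (s := (1 + β.re) / 2 - 1) (p := 1) (b := x ^ 2)
    (by linarith) one_pos (by positivity)
  refine Integrable.mono' h (by fun_prop) ?_
  filter_upwards [ae_restrict_mem measurableSet_Ioi] with t ht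
  rw [norm_gaussKernel β ht, Real.rpow_one, neg_mul]

theorem integral_gaussKernel_left {β : ℂ} (hβ : -1 < β.re) {x : ℝ} (hx : x ≠ 0) :
    ∫ t in Set.Ioi 0, gaussKernel β t x
      = Complex.Gamma ((1 + β) / 2) / ((|x| : ℝ) : ℂ) ^ (1 + β) := by
  have hx2 : 0 < x ^ 2 := by positivity
  have h := Complex.integral_cpow_mul_exp_neg_mul_Ioi (a := (1 + β) / 2) (r := x ^ 2)
    (by simp; linarith) hx2
  unfold gaussKernel
  rw [h, one_div, ← sq_abs, Complex.inv_cpow, mul_comm, div_eq_mul_inv]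
  · congr 2
    have hx' : 0 ≤ |x| := abs_nonneg _
    rw [pow_two, Complex.ofReal_mul, Complex.mul_cpow_ofReal_nonneg hx' hx',
      ← Complex.cpow_add _ _ (by simpa using hx)]
    congr 1; ring
  · rw [Complex.arg_ofReal_of_nonneg (by positivity)]
    exact Real.pi_pos.ne

theorem integral_norm_gaussKernel_left {β : ℂ} (hβ : -1 < β.re) {x : ℝ} (hx : x ≠ 0) :
    ∫ t in Set.Ioi 0, ‖gaussKernel β t x‖
      = Real.Gamma ((1 + β.re) / 2) / ‖((|x| : ℝ) : ℂ) ^ (1 + β)‖ := by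
  have hx' : 0 < |x| := abs_pos.2 hx
  have h := Real.integral_rpow_mul_exp_neg_mul_Ioi (a := (1 + β.re) / 2) (r := x ^ 2)
    (by linarith) (by positivity)
  rw [setIntegral_congr_fun measurableSet_Ioi fun t ht => norm_gaussKernel β ht x, h,
    Complex.norm_cpow_eq_rpow_re_of_pos hx', mul_comm, one_div, Real.inv_rpow (by positivity),
    div_eq_mul_inv, ← sq_abs, ← Real.rpow_natCast, ← Real.rpow_mul hx'.le]
  congr 3
  simp; ring

theorem integrable_gaussKernel_right (β : ℂ) {t : ℝ} (ht : 0 < t) :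
    Integrable (fun x => gaussKernel β t x) := by
  have h := (integrable_exp_neg_mul_sq ht).const_mul (t ^ ((1 + β.re) / 2 - 1))
  refine h.mono' (by fun_prop) (.of_forall fun x => ?_)
  rw [norm_gaussKernel β ht, mul_comm (x ^ 2), neg_mul]

theorem integral_exp_mul_gaussKernel (β : ℂ) {t : ℝ} (ht : 0 < t) (u : ℝ) :
    ∫ x : ℝ, Complex.exp (Complex.I * (x * u : ℝ)) * gaussKernel β t x
      = gaussKernelFourier β t u := by
  have h := fourierIntegral_gaussian (b := t) (by simpa using ht) u
  have e : ∀ x : ℝ, Complex.exp (Complex.I * (x * u : ℝ)) * gaussKernel β t x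
      = (t : ℂ) ^ ((1 + β) / 2 - 1) *
        (Complex.exp (Complex.I * u * x) * Complex.exp (-t * x ^ 2)) := by
    intro x
    have e1 : Complex.I * (x * u : ℝ) = Complex.I * u * x := by push_cast; ring
    have e2 : -(((x ^ 2 : ℝ) : ℂ) * t) = -t * x ^ 2 := by push_cast; ring
    rw [gaussKernel, e1, e2]; ring
  simp_rw [e]
  have htc : (t : ℂ) ≠ 0 := by exact_mod_cast ht.ne'
  rw [integral_const_mul, h, gaussKernelFourier,
    show (Real.pi : ℂ) / t = (Real.pi : ℝ) * (t⁻¹ : ℝ) by push_cast; rw [div_eq_mul_inv],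
    Complex.mul_cpow_ofReal_nonneg Real.pi_pos.le (by positivity), Complex.ofReal_inv,
    Complex.inv_cpow, ← Complex.cpow_neg]
  · have e3 : (t : ℂ) ^ (β / 2 - 1) = (t : ℂ) ^ ((1 + β) / 2 - 1) * (t : ℂ) ^ (-(1 / 2) : ℂ) := by
      rw [← Complex.cpow_add _ _ htc]; congr 1; ring
    have e4 : ((√Real.pi : ℝ) : ℂ) = (Real.pi : ℂ) ^ (1 / 2 : ℂ) := by
      rw [Real.sqrt_eq_rpow, Complex.ofReal_cpow Real.pi_pos.le]; norm_num
    rw [e3, e4]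
    have e5 : -(u : ℂ) ^ 2 / (4 * t) = -((u ^ 2 / 4 : ℝ) * (t⁻¹ : ℝ)) := by
      push_cast; field_simp
    rw [e5, Complex.ofReal_inv]; ring
  · rw [Complex.arg_ofReal_of_nonneg ht.le]
    exact Real.pi_pos.ne

theorem integral_gaussKernelFourier {β : ℂ} (hβ : β.re < 0) (u : ℝ) :
    ∫ t in Set.Ioi 0, gaussKernelFourier β t u
      = (√Real.pi : ℝ) * (Complex.Gamma (-β / 2) * 2 ^ (-β)) * ((|u| : ℝ) : ℂ) ^ β := by
  have hβ' : β ≠ 0 := by rintro rfl; simp at hβ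
  unfold gaussKernelFourier
  rw [integral_const_mul, mul_assoc]
  congr 1
  -- The substitution `t ↦ 1/t` turns the integral into a Gamma integral with exponent `-β/2`.
  have h := mellin_comp_inv (fun t => Complex.exp (-((u ^ 2 / 4 : ℝ) * (t : ℝ)))) (β / 2)
  simp only [mellin, smul_eq_mul] at h
  rw [h]
  -- At `u = 0` the integral diverges and has the default value `0`, which agrees with the
  -- convention `0 ^ β = 0`. The identity thus holds for every `u`, and null events such as `U = 0`
  -- need no separate treatment.
  by_cases hu : u = 0
  · subst hu
    simp only [ne_eq, OfNat.ofNat_ne_zero, not_false_eq_true, zero_pow, zero_div,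
      Complex.ofReal_zero, zero_mul, neg_zero, Complex.exp_zero, mul_one, abs_zero]
    rw [setIntegral_Ioi_zero_cpow, Complex.zero_cpow hβ', mul_zero]
  · have hu' : 0 < |u| := abs_pos.2 hu
    rw [Complex.integral_cpow_mul_exp_neg_mul_Ioi (by simp; linarith) (by positivity), one_div,
      Complex.inv_cpow, ← Complex.cpow_neg, mul_comm, neg_div, mul_assoc]
    · congr 1
      rw [neg_neg, ← sq_abs, show |u| ^ 2 / 4 = (|u| / 2) * (|u| / 2) by ring, Complex.ofReal_mul,
        Complex.mul_cpow_ofReal_nonneg (by positivity) (by positivity),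
        ← Complex.cpow_add _ _ (by exact_mod_cast (by positivity : |u| / 2 ≠ 0)), add_halves,
        div_eq_mul_inv, Complex.ofReal_mul,
        Complex.mul_cpow_ofReal_nonneg (by positivity) (by positivity), mul_comm,
        Complex.cpow_neg, Complex.ofReal_inv, Complex.inv_cpow]
      · simp
      · rw [Complex.arg_ofReal_of_nonneg (by positivity)]
        exact Real.pi_pos.ne
    · rw [Complex.arg_ofReal_of_nonneg (by positivity)]
      exact Real.pi_pos.ne

/-! ### Fubini and the formula for the joint moment. -/

section MomentFormula

variable {Ω : Type*} [MeasurableSpace Ω] {P : Measure Ω} {U V : Ω → ℝ} {β : ℂ}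

theorem aestronglyMeasurable_integral_exp [IsProbabilityMeasure P] (hU : AEMeasurable U P)
    (hV : AEMeasurable V P) :
    AEStronglyMeasurable (fun p : ℝ × ℝ =>
      ∫ ω, Complex.exp (Complex.I * (p.1 * U ω + p.2 * V ω : ℝ)) ∂P) := by
  have hU' : AEMeasurable (fun z : (ℝ × ℝ) × Ω => U z.2) (volume.prod P) := hU.comp_snd
  have hV' : AEMeasurable (fun z : (ℝ × ℝ) × Ω => V z.2) (volume.prod P) := hV.comp_snd
  have : AEStronglyMeasurable (fun z : (ℝ × ℝ) × Ω =>
      Complex.exp (Complex.I * (z.1.1 * U z.2 + z.1.2 * V z.2 : ℝ))) (volume.prod P) :=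
    AEMeasurable.aestronglyMeasurable (by fun_prop)
  exact this.integral_prod_right'

theorem ae_prod_ne_zero : ∀ᵐ p : ℝ × ℝ, p.1 ≠ 0 ∧ p.2 ≠ 0 := by
  have h : ∀ᵐ x : ℝ, x ≠ 0 := by simp [ae_iff]
  have h1 : ∀ᵐ p : ℝ × ℝ, p.1 ≠ 0 := Measure.quasiMeasurePreserving_fst.ae h
  have h2 : ∀ᵐ p : ℝ × ℝ, p.2 ≠ 0 := Measure.quasiMeasurePreserving_snd.ae h
  exact h1.and h2

/-- The product of two Gaussian kernels against the characteristic function of `(U, V)`. -/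
noncomputable def charKernel {Ω : Type*} [MeasurableSpace Ω] (P : Measure Ω) (U V : Ω → ℝ)
    (β : ℂ) (z : (ℝ × ℝ) × (ℝ × ℝ)) : ℂ :=
  (∫ ω, Complex.exp (Complex.I * (z.1.1 * U ω + z.1.2 * V ω : ℝ)) ∂P) *
    (gaussKernel β z.2.1 z.1.1 * gaussKernel (conj β) z.2.2 z.1.2)

/-- The measure on the pairs of subordination parameters. -/
noncomputable abbrev quadrantMeasure : Measure (ℝ × ℝ) :=
  ((volume : Measure ℝ).restrict (Set.Ioi 0)).prod (volume.restrict (Set.Ioi 0))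

theorem ae_quadrantMeasure : ∀ᵐ q ∂quadrantMeasure, 0 < q.1 ∧ 0 < q.2 := by
  have h : ∀ᵐ t : ℝ ∂(volume.restrict (Set.Ioi 0)), 0 < t := ae_restrict_mem measurableSet_Ioi
  exact (Measure.quasiMeasurePreserving_fst.ae h).and (Measure.quasiMeasurePreserving_snd.ae h)

theorem integral_charKernel (hβ : -1 < β.re) {p : ℝ × ℝ} (hp : p.1 ≠ 0 ∧ p.2 ≠ 0) :
    ∫ q, charKernel P U V β (p, q) ∂quadrantMeasure
      = Complex.Gamma ((1 + β) / 2) * Complex.Gamma ((1 + conj β) / 2)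
        * charIntegrand P U V β p := by
  have hβ' : -1 < (conj β).re := by simpa using hβ
  simp only [charKernel]
  rw [integral_const_mul, integral_prod_mul (fun t => gaussKernel β t p.1)
    (fun t => gaussKernel (conj β) t p.2), integral_gaussKernel_left hβ hp.1,
    integral_gaussKernel_left hβ' hp.2, charIntegrand]
  ring

theorem integrable_charKernel [IsProbabilityMeasure P] (hU : AEMeasurable U P)
    (hV : AEMeasurable V P) (hβ : -1 < β.re) (hint : Integrable (charIntegrand P U V β)) :
    Integrable (charKernel P U V β) (volume.prod quadrantMeasure) := by
  have hβ' : -1 < (conj β).re := by simpa using hβ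
  have hm : AEStronglyMeasurable (charKernel P U V β) (volume.prod quadrantMeasure) := by
    unfold charKernel
    refine (aestronglyMeasurable_integral_exp hU hV).comp_fst.mul ?_
    exact Measurable.aestronglyMeasurable (by fun_prop)
  rw [integrable_prod_iff hm]
  constructor
  · filter_upwards [ae_prod_ne_zero] with p hp
    simp only [charKernel]
    exact ((integrable_gaussKernel_left hβ hp.1).mul_prod
      (integrable_gaussKernel_left hβ' hp.2)).const_mul _
  · refine (hint.norm.const_mul
      (Real.Gamma ((1 + β.re) / 2) * Real.Gamma ((1 + (conj β).re) / 2))).congr ?_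
    filter_upwards [ae_prod_ne_zero] with p hp
    simp only [charKernel, norm_mul]
    rw [integral_const_mul, integral_prod_mul (fun t => ‖gaussKernel β t p.1‖)
      (fun t => ‖gaussKernel (conj β) t p.2‖), integral_norm_gaussKernel_left hβ hp.1,
      integral_norm_gaussKernel_left hβ' hp.2, charIntegrand, norm_div, norm_mul]
    ring

theorem integral_charKernel_left [IsProbabilityMeasure P] (hU : AEMeasurable U P)
    (hV : AEMeasurable V P) {q : ℝ × ℝ} (hq : 0 < q.1 ∧ 0 < q.2) :
    ∫ p, charKernel P U V β (p, q)
      = ∫ ω, gaussKernelFourier β q.1 (U ω) * gaussKernelFourier (conj β) q.2 (V ω) ∂P := by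
  have hk : Integrable (fun p : ℝ × ℝ => gaussKernel β q.1 p.1 * gaussKernel (conj β) q.2 p.2) :=
    (integrable_gaussKernel_right β hq.1).mul_prod (integrable_gaussKernel_right (conj β) hq.2)
  have hU' : AEMeasurable (fun z : (ℝ × ℝ) × Ω => U z.2) (volume.prod P) := hU.comp_snd
  have hV' : AEMeasurable (fun z : (ℝ × ℝ) × Ω => V z.2) (volume.prod P) := hV.comp_snd
  have hi : Integrable (Function.uncurry fun (p : ℝ × ℝ) (ω : Ω) =>
      Complex.exp (Complex.I * (p.1 * U ω + p.2 * V ω : ℝ)) *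
        (gaussKernel β q.1 p.1 * gaussKernel (conj β) q.2 p.2)) (volume.prod P) := by
    refine (hk.comp_fst P).bdd_mul (c := 1) (AEMeasurable.aestronglyMeasurable (by fun_prop))
      (.of_forall fun z => ?_)
    rw [mul_comm, Complex.norm_exp_ofReal_mul_I]
  simp only [charKernel, ← integral_mul_const]
  rw [integral_integral_swap hi]
  refine integral_congr_ae (.of_forall fun ω => ?_)
  dsimp only
  rw [← integral_exp_mul_gaussKernel β hq.1, ← integral_exp_mul_gaussKernel (conj β) hq.2,
    ← integral_prod_mul]
  refine integral_congr_ae (.of_forall fun p => ?_)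
  dsimp only
  rw [Complex.ofReal_add, mul_add, Complex.exp_add]
  ring

theorem norm_gaussKernelFourier_le (β : ℂ) {t : ℝ} (ht : 0 < t) (u : ℝ) :
    ‖gaussKernelFourier β t u‖ ≤ √Real.pi * t ^ (β.re / 2 - 1) := by
  rw [gaussKernelFourier, norm_mul, norm_mul, Complex.norm_cpow_eq_rpow_re_of_pos ht,
    Complex.norm_exp, Complex.norm_real, Real.norm_of_nonneg (Real.sqrt_nonneg _)]
  have : Real.exp (-((u ^ 2 / 4 : ℝ) * (t⁻¹ : ℝ)) : ℂ).re ≤ 1 := by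
    rw [Real.exp_le_one_iff, ← Complex.ofReal_mul, Complex.neg_re, Complex.ofReal_re,
      neg_nonpos]
    positivity
  have e : (β / 2 - 1).re = β.re / 2 - 1 := by simp
  rw [e]
  have h0 : 0 ≤ t ^ (β.re / 2 - 1) := by positivity
  gcongr
  nlinarith

/-- Taking the norm only replaces `β` by its real part. Absolute integrability for complex `β` can
therefore be read off from the exchange of integrals for a real exponent. -/
theorem norm_gaussKernelFourier (β : ℂ) {t : ℝ} (ht : 0 < t) (u : ℝ) :
    (‖gaussKernelFourier β t u‖ : ℂ) = gaussKernelFourier (β.re : ℂ) t u := by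
  rw [gaussKernelFourier, gaussKernelFourier, norm_mul, norm_mul,
    Complex.norm_cpow_eq_rpow_re_of_pos ht, Complex.norm_exp, Complex.norm_real,
    Real.norm_of_nonneg (Real.sqrt_nonneg _), ← Complex.ofReal_mul, ← Complex.ofReal_neg,
    Complex.ofReal_re]
  push_cast
  rw [Complex.ofReal_cpow ht.le]
  simp

theorem norm_charKernel (z : (ℝ × ℝ) × (ℝ × ℝ)) (h1 : 0 < z.2.1) (h2 : 0 < z.2.2) :
    ‖charKernel P U V (β.re : ℂ) z‖ = ‖charKernel P U V β z‖ := by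
  simp [charKernel, norm_gaussKernel _ h1, norm_gaussKernel _ h2]

theorem integrable_gaussKernelFourier_mul [IsProbabilityMeasure P] (hU : AEMeasurable U P)
    (hV : AEMeasurable V P) (hβ : -1 < β.re) (hint : Integrable (charIntegrand P U V β)) :
    Integrable (fun z : (ℝ × ℝ) × Ω =>
      gaussKernelFourier β z.1.1 (U z.2) * gaussKernelFourier (conj β) z.1.2 (V z.2))
      (quadrantMeasure.prod P) := by
  have hU' : AEMeasurable (fun z : (ℝ × ℝ) × Ω => U z.2) (quadrantMeasure.prod P) := hU.comp_snd
  have hV' : AEMeasurable (fun z : (ℝ × ℝ) × Ω => V z.2) (quadrantMeasure.prod P) := hV.comp_snd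
  have hm : AEStronglyMeasurable (fun z : (ℝ × ℝ) × Ω =>
      gaussKernelFourier β z.1.1 (U z.2) * gaussKernelFourier (conj β) z.1.2 (V z.2))
      (quadrantMeasure.prod P) := AEMeasurable.aestronglyMeasurable (by fun_prop)
  rw [integrable_prod_iff hm]
  constructor
  · filter_upwards [ae_quadrantMeasure] with q hq
    refine Integrable.mono' (integrable_const
      ((√Real.pi * q.1 ^ (β.re / 2 - 1)) * (√Real.pi * q.2 ^ ((conj β).re / 2 - 1))))
      (AEMeasurable.aestronglyMeasurable (by fun_prop)) (.of_forall fun ω => ?_)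
    rw [norm_mul]
    exact mul_le_mul (norm_gaussKernelFourier_le β hq.1 _)
      (norm_gaussKernelFourier_le (conj β) hq.2 _) (norm_nonneg _)
      (mul_nonneg (Real.sqrt_nonneg _) (Real.rpow_nonneg hq.1.le _))
  · refine (integrable_charKernel hU hV hβ hint).integral_norm_prod_right.mono'
      hm.norm.integral_prod_right' ?_
    filter_upwards [ae_quadrantMeasure] with q hq
    -- The mean of the norm is itself a `charKernel` integral, with exponent `β.re`. It is dominated
    -- by the integral of `‖charKernel‖`, which is the same for `β.re` and `β` and is integrable in
    -- `q`.
    have e : ((∫ ω, ‖gaussKernelFourier β q.1 (U ω) * gaussKernelFourier (conj β) q.2 (V ω)‖ ∂P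
        : ℝ) : ℂ) = ∫ p, charKernel P U V (β.re : ℂ) (p, q) := by
      rw [integral_charKernel_left hU hV hq, ← integral_complex_ofReal]
      simp only [norm_mul, Complex.ofReal_mul, norm_gaussKernelFourier _ hq.1,
        norm_gaussKernelFourier _ hq.2, Complex.conj_re, Complex.conj_ofReal]
    rw [← Complex.norm_real, e]
    refine (norm_integral_le_integral_norm _).trans (le_of_eq ?_)
    refine integral_congr_ae (.of_forall fun p => ?_)
    exact norm_charKernel _ hq.1 hq.2

/-- The joint moment of complex powers in terms of the joint characteristic function. -/
theorem integrable_and_integral_absCpow_mul [IsProbabilityMeasure P] (hU : AEMeasurable U P)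
    (hV : AEMeasurable V P) (hβ₁ : -1 < β.re) (hβ₀ : β.re < 0)
    (hint : Integrable (charIntegrand P U V β)) :
    Integrable (fun ω => absCpow U β ω * absCpow V (conj β) ω) P ∧
      ∫ ω, absCpow U β ω * absCpow V (conj β) ω ∂P
        = fourierConst β * fourierConst (conj β) / (2 * Real.pi)
          * ∫ p : ℝ × ℝ, charIntegrand P U V β p := by
  have hβ₀' : (conj β).re < 0 := by simpa using hβ₀
  set a : ℂ := (√Real.pi : ℝ) * (Complex.Gamma (-β / 2) * 2 ^ (-β)) with ha
  set b : ℂ := (√Real.pi : ℝ) * (Complex.Gamma (-(conj β) / 2) * 2 ^ (-(conj β))) with hb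
  have hπ : ((√Real.pi : ℝ) : ℂ) ≠ 0 := by
    exact_mod_cast (Real.sqrt_pos.2 Real.pi_pos).ne'
  have h2 : ∀ s : ℂ, (2 : ℂ) ^ s ≠ 0 := fun s => by simp [Complex.cpow_eq_zero_iff]
  have hΓ1 : Complex.Gamma (-β / 2) ≠ 0 :=
    Complex.Gamma_ne_zero_of_re_pos (by simp; linarith)
  have hΓ2 : Complex.Gamma (-(conj β) / 2) ≠ 0 :=
    Complex.Gamma_ne_zero_of_re_pos (by simp; linarith)
  have ha0 : a ≠ 0 := mul_ne_zero hπ (mul_ne_zero hΓ1 (h2 _))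
  have hb0 : b ≠ 0 := mul_ne_zero hπ (mul_ne_zero hΓ2 (h2 _))
  have hG := integrable_gaussKernelFourier_mul hU hV hβ₁ hint
  have hinner : ∀ ω, ∫ q, gaussKernelFourier β q.1 (U ω) * gaussKernelFourier (conj β) q.2 (V ω)
      ∂quadrantMeasure = a * b * (absCpow U β ω * absCpow V (conj β) ω) := by
    intro ω
    rw [integral_prod_mul (fun t => gaussKernelFourier β t (U ω))
      (fun t => gaussKernelFourier (conj β) t (V ω)), integral_gaussKernelFourier hβ₀,
      integral_gaussKernelFourier hβ₀', absCpow, absCpow]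
    ring
  have hI := hG.integral_prod_right
  simp only [hinner] at hI
  have hI' : Integrable (fun ω => absCpow U β ω * absCpow V (conj β) ω) P := by
    refine (hI.const_mul (a * b)⁻¹).congr (.of_forall fun ω => ?_)
    dsimp only
    rw [inv_mul_cancel_left₀ (mul_ne_zero ha0 hb0)]
  refine ⟨hI', ?_⟩
  have e1 : a * b * ∫ ω, absCpow U β ω * absCpow V (conj β) ω ∂P
      = Complex.Gamma ((1 + β) / 2) * Complex.Gamma ((1 + conj β) / 2)
        * ∫ p : ℝ × ℝ, charIntegrand P U V β p := by
    calc a * b * ∫ ω, absCpow U β ω * absCpow V (conj β) ω ∂P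
        = ∫ ω, ∫ q, gaussKernelFourier β q.1 (U ω) * gaussKernelFourier (conj β) q.2 (V ω)
            ∂quadrantMeasure ∂P := by simp only [hinner, integral_const_mul]
      _ = ∫ q, ∫ ω, gaussKernelFourier β q.1 (U ω) * gaussKernelFourier (conj β) q.2 (V ω)
            ∂P ∂quadrantMeasure := (integral_integral_swap hG).symm
      _ = ∫ q, (∫ p, charKernel P U V β (p, q)) ∂quadrantMeasure := by
          refine integral_congr_ae ?_
          filter_upwards [ae_quadrantMeasure] with q hq
          rw [integral_charKernel_left hU hV hq]
      _ = ∫ p, ∫ q, charKernel P U V β (p, q) ∂quadrantMeasure :=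
          (integral_integral_swap (f := fun p q => charKernel P U V β (p, q))
            (integrable_charKernel hU hV hβ₁ hint)).symm
      _ = _ := by
          rw [← integral_const_mul]
          refine integral_congr_ae ?_
          filter_upwards [ae_prod_ne_zero] with p hp
          exact integral_charKernel hβ₁ hp
  refine mul_left_cancel₀ (mul_ne_zero ha0 hb0) ?_
  rw [e1, ← mul_assoc]
  congr 1
  -- What remains is `a * b * C_β * C_(conj β) / (2π) = Γ((1 + β)/2) Γ((1 + conj β)/2)`: the Gamma
  -- factors of the denominators cancel, and the powers of `2` and `√π` combine to `2π`.
  have hsq : ((√Real.pi : ℝ) : ℂ) * (√Real.pi : ℝ) = Real.pi := by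
    exact_mod_cast Real.mul_self_sqrt Real.pi_pos.le
  have hpi : (Real.pi : ℂ) ≠ 0 := by exact_mod_cast Real.pi_ne_zero
  have hpow : ∀ s : ℂ, (2 : ℂ) ^ (-s) * 2 ^ (s + 1 / 2) = 2 ^ (1 / 2 : ℂ) := fun s => by
    rw [← Complex.cpow_add _ _ two_ne_zero]; congr 1; ring
  have htwo : (2 : ℂ) ^ (1 / 2 : ℂ) * 2 ^ (1 / 2 : ℂ) = 2 := by
    rw [← Complex.cpow_add _ _ two_ne_zero]; norm_num
  rw [ha, hb, fourierConst, fourierConst, add_comm β 1, add_comm (conj β) 1]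
  have : (√Real.pi : ℝ) * (Complex.Gamma (-β / 2) * 2 ^ (-β)) *
      ((√Real.pi : ℝ) * (Complex.Gamma (-(conj β) / 2) * 2 ^ (-(conj β)))) *
      (2 ^ (β + 1 / 2) * Complex.Gamma ((1 + β) / 2) / Complex.Gamma (-β / 2) *
        (2 ^ (conj β + 1 / 2) * Complex.Gamma ((1 + conj β) / 2) / Complex.Gamma (-(conj β) / 2)) /
        (2 * Real.pi))
      = ((√Real.pi : ℝ) * (√Real.pi : ℝ)) * ((2 ^ (-β) * 2 ^ (β + 1 / 2)) *
        (2 ^ (-(conj β)) * 2 ^ (conj β + 1 / 2))) *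
        (Complex.Gamma ((1 + β) / 2) * Complex.Gamma ((1 + conj β) / 2)) / (2 * Real.pi) := by
    generalize Complex.Gamma (-β / 2) = G₁ at hΓ1
    generalize Complex.Gamma (-(conj β) / 2) = G₂ at hΓ2
    field_simp
  rw [this, hpow, hpow, htwo, hsq]
  field_simp

end MomentFormula

/-! ### Weighted integrals and exponential differences. -/

theorem integrable_abs_rpow_mul_exp {s c α : ℝ} (hs : -1 < s) (hc : 0 < c) (hα : 0 < α) :
    Integrable (fun x : ℝ => |x| ^ s * Real.exp (-(c * |x| ^ α))) := by
  have h := integrableOn_rpow_mul_exp_neg_mul_rpow hs hα hc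
  have h1 : IntegrableOn (fun x : ℝ => |x| ^ s * Real.exp (-(c * |x| ^ α))) (Set.Ioi 0) := by
    refine h.congr_fun (fun x hx => ?_) measurableSet_Ioi
    dsimp only
    rw [abs_of_pos hx, neg_mul]
  have h2 : IntegrableOn (fun x : ℝ => |x| ^ s * Real.exp (-(c * |x| ^ α))) (Set.Iic 0) := by
    rw [integrableOn_Iic_iff_integrableOn_Iio]
    have := h1.comp_neg
    simpa using this
  rw [← integrableOn_univ, ← Set.Iic_union_Ioi (a := (0 : ℝ))]
  exact h2.union h1

theorem abs_exp_neg_sub_exp_neg_le {a b m : ℝ} (ha : m ≤ a) (hb : m ≤ b) :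
    |Real.exp (-a) - Real.exp (-b)| ≤ |a - b| * Real.exp (-m) := by
  wlog hab : a ≤ b generalizing a b
  · rw [abs_sub_comm, abs_sub_comm a]
    exact this hb ha (le_of_not_ge hab)
  have h1 : Real.exp (-b) = Real.exp (-a) * Real.exp (-(b - a)) := by
    rw [← Real.exp_add]; congr 1; ring
  have h2 := Real.add_one_le_exp (-(b - a))
  have h3 : Real.exp (-a) ≤ Real.exp (-m) := Real.exp_le_exp.2 (by linarith)
  have h4 : Real.exp (-(b - a)) ≤ 1 := Real.exp_le_one_iff.2 (by linarith)
  have h5 := Real.exp_pos (-a)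
  rw [h1, abs_of_nonneg (by nlinarith), abs_of_nonpos (by linarith)]
  nlinarith

theorem conj_absCpow {Ω : Type*} (U : Ω → ℝ) (β : ℂ) (ω : Ω) :
    conj (absCpow U β ω) = absCpow U (conj β) ω := by
  rw [absCpow, absCpow, Complex.cpow_conj, Complex.conj_ofReal]
  rw [Complex.arg_ofReal_of_nonneg (abs_nonneg _)]
  exact Real.pi_pos.ne

theorem absCpow_ne_zero {Ω : Type*} {β : ℂ} {U : Ω → ℝ} {ω : Ω} (h : U ω ≠ 0) : absCpow U β ω ≠ 0 := by
  simp [absCpow, Complex.cpow_eq_zero_iff, h]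

/-! ### Comparison of the exponent with the independent case. -/

section Codifference

variable {S : Type*} [MeasurableSpace S] {μ : Measure S} {α : ℝ} {h g : S → ℝ}

theorem abs_integral_linear_comb_rpow_sub_le (hα₀ : 0 < α) (hα₂ : α ≤ 2)
    (hh : MemLp h (ENNReal.ofReal α) μ) (hg : MemLp g (ENNReal.ofReal α) μ)
    (hh1 : ∫ s, |h s| ^ α ∂μ = 1) (hg1 : ∫ s, |g s| ^ α ∂μ = 1) (x y : ℝ) :
    |∫ s, |x * h s + y * g s| ^ α ∂μ - (|x| ^ α + |y| ^ α)|
      ≤ 2 * |x * y| ^ (α / 2) * ∫ s, |h s * g s| ^ (α / 2) ∂μ := by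
  have i1 : Integrable (fun s => |x * h s + y * g s| ^ α) μ :=
    MemLp.integrable_abs_rpow hα₀ ((hh.const_mul x).add (hg.const_mul y))
  have i2 := (hh.integrable_abs_rpow hα₀).const_mul (|x| ^ α)
  have i3 := (hg.integrable_abs_rpow hα₀).const_mul (|y| ^ α)
  have i4 := (integrable_abs_mul_rpow_half hα₀ hh hg).const_mul (2 * |x * y| ^ (α / 2))
  have e : |x| ^ α + |y| ^ α = ∫ s, (|x| ^ α * |h s| ^ α + |y| ^ α * |g s| ^ α) ∂μ := by
    rw [integral_add i2 i3, integral_const_mul, integral_const_mul, hh1, hg1, mul_one, mul_one]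
  have i5 : Integrable (fun s => |x| ^ α * |h s| ^ α + |y| ^ α * |g s| ^ α) μ := i2.add i3
  rw [e, ← integral_sub i1 i5, ← integral_const_mul]
  refine abs_integral_le_integral_abs.trans (integral_mono (i1.sub i5).abs i4 fun s => ?_)
  have := abs_rpow_add_sub_le hα₀ hα₂ (x * h s) (y * g s)
  rw [show x * h s * (y * g s) = (x * y) * (h s * g s) by ring, abs_mul (x * y),
    Real.mul_rpow (abs_nonneg _) (abs_nonneg _), abs_mul x, abs_mul y,
    Real.mul_rpow (abs_nonneg _) (abs_nonneg _), Real.mul_rpow (abs_nonneg _) (abs_nonneg _)] at this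
  dsimp only
  rw [← sub_sub, mul_assoc]
  exact this

theorem le_integral_linear_comb_rpow (hα₀ : 0 < α) (hα₂ : α ≤ 2)
    (hh : MemLp h (ENNReal.ofReal α) μ) (hg : MemLp g (ENNReal.ofReal α) μ)
    (hh1 : ∫ s, |h s| ^ α ∂μ = 1) (hg1 : ∫ s, |g s| ^ α ∂μ = 1) (x y : ℝ) :
    (1 - ∫ s, |h s * g s| ^ (α / 2) ∂μ) * (|x| ^ α + |y| ^ α)
      ≤ ∫ s, |x * h s + y * g s| ^ α ∂μ := by
  have h1 := (abs_le.1 (abs_integral_linear_comb_rpow_sub_le hα₀ hα₂ hh hg hh1 hg1 x y)).1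
  -- The error `2 |x y| ^ (α/2) κ` is absorbed into `κ (|x| ^ α + |y| ^ α)`.
  have h2 := abs_mul_rpow_half_le (α := α) x y
  have h3 : 0 ≤ ∫ s, |h s * g s| ^ (α / 2) ∂μ := integral_nonneg fun s => by positivity
  nlinarith

end Codifference

/-! ### Integrability and comparison of characteristic integrals. -/

section Bounds

variable {Ω : Type*} [MeasurableSpace Ω] {P : Measure Ω} {U V : Ω → ℝ} {β : ℂ} {α c : ℝ}

theorem norm_charIntegrand_denom (β : ℂ) {p : ℝ × ℝ} (hp : p.1 ≠ 0 ∧ p.2 ≠ 0) :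
    ‖((|p.1| : ℝ) : ℂ) ^ (1 + β) * ((|p.2| : ℝ) : ℂ) ^ (1 + conj β)‖⁻¹
      = |p.1| ^ (-(1 + β.re)) * |p.2| ^ (-(1 + β.re)) := by
  rw [norm_mul, Complex.norm_cpow_eq_rpow_re_of_pos (abs_pos.2 hp.1),
    Complex.norm_cpow_eq_rpow_re_of_pos (abs_pos.2 hp.2), mul_inv,
    ← Real.rpow_neg (abs_nonneg _), ← Real.rpow_neg (abs_nonneg _)]
  simp

theorem integrable_charIntegrand [IsProbabilityMeasure P] (hU : AEMeasurable U P)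
    (hV : AEMeasurable V P) (hβ₀ : β.re < 0) (hα : 0 < α) (hc : 0 < c)
    (hφ : ∀ x y : ℝ, ‖∫ ω, Complex.exp (Complex.I * (x * U ω + y * V ω : ℝ)) ∂P‖
      ≤ Real.exp (-(c * (|x| ^ α + |y| ^ α)))) :
    Integrable (charIntegrand P U V β) := by
  have hw := integrable_abs_rpow_mul_exp (s := -(1 + β.re)) (by linarith) hc hα
  refine (hw.mul_prod hw).mono' ?_ ?_
  · unfold charIntegrand
    refine (aestronglyMeasurable_integral_exp hU hV).div₀ ?_
    exact Measurable.aestronglyMeasurable (by fun_prop)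
  · filter_upwards [ae_prod_ne_zero] with p hp
    rw [charIntegrand, norm_div, div_eq_mul_inv, norm_charIntegrand_denom β hp]
    refine (mul_le_mul_of_nonneg_right (hφ p.1 p.2) (by positivity)).trans (le_of_eq ?_)
    rw [mul_add, neg_add, Real.exp_add]
    ring

/-- The majorant factors into a function of `x` times the same function of `y`, hence the square.
The second pair will be the independent copies on `P.prod P`. -/
theorem norm_integral_sub_charIntegrand_le {Ω' : Type*} [MeasurableSpace Ω'] {P' : Measure Ω'}
    {U' V' : Ω' → ℝ} {κ : ℝ} (hβ₀ : β.re < 0) (hα : 0 < α) (hc : 0 < c)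
    (hi : Integrable (charIntegrand P U V β)) (hi' : Integrable (charIntegrand P' U' V' β))
    (hφ : ∀ x y : ℝ, ‖∫ ω, Complex.exp (Complex.I * (x * U ω + y * V ω : ℝ)) ∂P
        - ∫ ω, Complex.exp (Complex.I * (x * U' ω + y * V' ω : ℝ)) ∂P'‖
      ≤ 2 * |x * y| ^ (α / 2) * κ * Real.exp (-(c * (|x| ^ α + |y| ^ α)))) :
    ‖(∫ p, charIntegrand P U V β p) - ∫ p, charIntegrand P' U' V' β p‖
      ≤ 2 * κ * (∫ x : ℝ, |x| ^ (α / 2 - (1 + β.re)) * Real.exp (-(c * |x| ^ α))) ^ 2 := by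
  have hw := integrable_abs_rpow_mul_exp (s := α / 2 - (1 + β.re)) (by linarith) hc hα
  rw [← integral_sub hi hi', pow_two, ← integral_prod_mul, ← integral_const_mul]
  refine norm_integral_le_of_norm_le ((hw.mul_prod hw).const_mul _) ?_
  filter_upwards [ae_prod_ne_zero] with p hp
  rw [charIntegrand, charIntegrand, ← sub_div, norm_div, div_eq_mul_inv,
    norm_charIntegrand_denom β hp]
  refine (mul_le_mul_of_nonneg_right (hφ p.1 p.2) (by positivity)).trans (le_of_eq ?_)
  rw [mul_add, neg_add, Real.exp_add, abs_mul, Real.mul_rpow (abs_nonneg _) (abs_nonneg _),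
    sub_eq_add_neg, Real.rpow_add (abs_pos.2 hp.1), Real.rpow_add (abs_pos.2 hp.2)]
  ring

theorem integral_exp_prod [IsProbabilityMeasure P] (x y : ℝ) :
    ∫ z : Ω × Ω, Complex.exp (Complex.I * (x * U z.1 + y * V z.2 : ℝ)) ∂(P.prod P)
      = (∫ ω, Complex.exp (Complex.I * (x * U ω + 0 * V ω : ℝ)) ∂P) *
        ∫ ω, Complex.exp (Complex.I * (0 * U ω + y * V ω : ℝ)) ∂P := by
  rw [← integral_prod_mul]
  refine integral_congr_ae (.of_forall fun z => ?_)
  dsimp only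
  rw [← Complex.exp_add, ← mul_add]
  push_cast
  congr 2
  ring

/-- Supplies a point at which a Fubini section is integrable and the frozen factor is nonzero, so
that this factor can be divided out. -/
theorem exists_mem_ne_zero_of_integral_exp_ne_one [IsProbabilityMeasure P] {Q : Ω → Prop}
    (hQ : ∀ᵐ ω ∂P, Q ω) (h : ∫ ω, Complex.exp (Complex.I * (V ω : ℝ)) ∂P ≠ 1) :
    ∃ ω, Q ω ∧ V ω ≠ 0 := by
  by_contra hcon
  push Not at hcon
  refine h ?_
  have : (fun ω => Complex.exp (Complex.I * (V ω : ℝ))) =ᵐ[P] fun _ => 1 := by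
    filter_upwards [hQ] with ω hω
    simp [hcon ω hω]
  rw [integral_congr_ae this]
  simp

theorem complexCov_eq [IsProbabilityMeasure P] {X Y : Ω → ℂ} (hX : Integrable X P)
    (hY : Integrable Y P) (hXY : Integrable (fun ω => X ω * conj (Y ω)) P) :
    complexCov P X Y = ∫ ω, X ω * conj (Y ω) ∂P - (∫ ω, X ω ∂P) * ∫ ω, conj (Y ω) ∂P := by
  have hY' : Integrable (fun ω => conj (Y ω)) P :=
    Complex.conjCLE.toContinuousLinearMap.integrable_comp hY
  set a := ∫ ω, X ω ∂P with ha
  have hb : conj (∫ ω, Y ω ∂P) = ∫ ω, conj (Y ω) ∂P := integral_conj.symm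
  have e : ∀ ω, (X ω - a) * conj (Y ω - ∫ ω', Y ω' ∂P)
      = X ω * conj (Y ω) - a * conj (Y ω) - (X ω * (∫ ω, conj (Y ω) ∂P)
        - a * ∫ ω, conj (Y ω) ∂P) := fun ω => by
    rw [map_sub, hb]; ring
  simp only [complexCov, ← ha, e]
  rw [integral_sub, integral_sub, integral_sub, integral_mul_const, integral_const_mul,
    integral_const]
  · simp [← ha]
  · exact hX.mul_const _
  · exact integrable_const _
  · exact hXY
  · exact hY'.const_mul _
  · exact hXY.sub (hY'.const_mul _)
  · exact (hX.mul_const _).sub (integrable_const _)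

end Bounds

/-! ### The main theorem. -/

theorem theorem4p2 (α : ℝ) (hα₀ : 0 < α) (hα₂ : α < 2)
    (β : ℂ) (hβ₁ : -(1 / 2) < β.re) (hβ₀ : β.re < 0) (η : ℝ) (hη : η < 1) :
    ∃ C : ℝ, ∀ (S : Type u) [MeasurableSpace S] (μ : Measure S)
      (Ω : Type v) [MeasurableSpace Ω] (P : Measure Ω) [IsProbabilityMeasure P]
      (M : Set S → Ω → ℝ) (h g : S → ℝ) (U V : Ω → ℝ),
      IsSymmStableRandomMeasure α μ P M →
      MemLp h (ENNReal.ofReal α) μ → MemLp g (ENNReal.ofReal α) μ →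
      IsStableIntegral α μ P M h U → IsStableIntegral α μ P M g V →
      ∫ s, |h s| ^ α ∂μ = 1 → ∫ s, |g s| ^ α ∂μ = 1 →
      ∫ s, |h s * g s| ^ (α / 2) ∂μ ≤ η →
      (Integrable (fun ω => absCpow U β ω * absCpow V (conj β) ω) P ∧
        Integrable (charIntegrand P U V β) ∧
        ∫ ω, absCpow U β ω * absCpow V (conj β) ω ∂P
          = fourierConst β * fourierConst (conj β) / (2 * Real.pi)
            * ∫ p : ℝ × ℝ, charIntegrand P U V β p) ∧
      (Integrable (absCpow U β) P ∧ Integrable (absCpow V β) P ∧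
        ‖complexCov P (absCpow U β) (absCpow V β)‖ ≤ C * ∫ s, |h s * g s| ^ (α / 2) ∂μ) := by
  refine ⟨‖fourierConst β * fourierConst (conj β) / (2 * Real.pi)‖ * (2 *
    (∫ x : ℝ, |x| ^ (α / 2 - (1 + β.re)) * Real.exp (-((1 - η) * |x| ^ α))) ^ 2), ?_⟩
  intro S _ μ Ω _ P _ M h g U V hM hh hg hU hV hh1 hg1 hκη
  set κ := ∫ s, |h s * g s| ^ (α / 2) ∂μ with hκ
  have hκ0 : 0 ≤ κ := integral_nonneg fun s => by positivity
  have hc : 0 < 1 - η := by linarith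
  have hβ : -1 < β.re := by linarith
  have hUm := hM.aemeasurable_of_isStableIntegral hU
  have hVm := hM.aemeasurable_of_isStableIntegral hV
  set N : ℝ → ℝ → ℝ := fun x y => ∫ s, |x * h s + y * g s| ^ α ∂μ with hN
  have hφ : ∀ x y : ℝ, ∫ ω, Complex.exp (Complex.I * (x * U ω + y * V ω : ℝ)) ∂P
      = (Real.exp (-N x y) : ℂ) := hM.integral_exp_stableIntegral hα₀ hα₂.le hh hg hU hV
  have hNx : ∀ x, N x 0 = |x| ^ α := fun x => by
    simp only [hN, zero_mul, add_zero, abs_mul, Real.mul_rpow (abs_nonneg _) (abs_nonneg _),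
      integral_const_mul, hh1, mul_one]
  have hNy : ∀ y, N 0 y = |y| ^ α := fun y => by
    simp only [hN, zero_mul, zero_add, abs_mul, Real.mul_rpow (abs_nonneg _) (abs_nonneg _),
      integral_const_mul, hg1, mul_one]
  have hφ' : ∀ x y : ℝ,
      ∫ z : Ω × Ω, Complex.exp (Complex.I * (x * U z.1 + y * V z.2 : ℝ)) ∂(P.prod P)
        = (Real.exp (-(|x| ^ α + |y| ^ α)) : ℂ) := fun x y => by
    rw [integral_exp_prod, hφ, hφ, hNx, hNy, ← Complex.ofReal_mul, ← Real.exp_add, neg_add]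
  have hpow : ∀ x y : ℝ, 0 ≤ |x| ^ α + |y| ^ α := fun x y => by positivity
  have hlow : ∀ x y, (1 - η) * (|x| ^ α + |y| ^ α) ≤ N x y := fun x y =>
    (mul_le_mul_of_nonneg_right (by linarith) (hpow x y)).trans
      (le_integral_linear_comb_rpow hα₀ hα₂.le hh hg hh1 hg1 x y)
  -- Here `0 ≤ κ ≤ η` forces `1 - η ≤ 1`, so both exponents share one lower bound.
  have hlow' : ∀ x y : ℝ, (1 - η) * (|x| ^ α + |y| ^ α) ≤ |x| ^ α + |y| ^ α := fun x y =>
    mul_le_of_le_one_left (hpow x y) (by linarith)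
  have hUm' : AEMeasurable (fun z : Ω × Ω => U z.1) (P.prod P) := hUm.comp_fst
  have hVm' : AEMeasurable (fun z : Ω × Ω => V z.2) (P.prod P) := hVm.comp_snd
  have hi : Integrable (charIntegrand P U V β) := by
    refine integrable_charIntegrand hUm hVm hβ₀ hα₀ hc fun x y => ?_
    rw [hφ, Complex.norm_real, Real.norm_of_nonneg (Real.exp_pos _).le]
    exact Real.exp_le_exp.2 (neg_le_neg (hlow x y))
  have hi' : Integrable (charIntegrand (P.prod P) (fun z => U z.1) (fun z => V z.2) β) := by
    refine integrable_charIntegrand hUm' hVm' hβ₀ hα₀ hc fun x y => ?_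
    rw [hφ', Complex.norm_real, Real.norm_of_nonneg (Real.exp_pos _).le]
    exact Real.exp_le_exp.2 (neg_le_neg (hlow' x y))
  obtain ⟨hXY, hXYint⟩ := integrable_and_integral_absCpow_mul hUm hVm hβ hβ₀ hi
  -- On `P.prod P` the coordinates carry independent copies of `U` and `V`, so this instance
  -- computes the product of the two means.
  obtain ⟨hprod, hprodint⟩ := integrable_and_integral_absCpow_mul hUm' hVm' hβ hβ₀ hi'
  have hprod' : Integrable (fun z : Ω × Ω => absCpow U β z.1 * absCpow V (conj β) z.2)
      (P.prod P) := hprod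
  have hprodint' : (∫ ω, absCpow U β ω ∂P) * ∫ ω, absCpow V (conj β) ω ∂P
      = fourierConst β * fourierConst (conj β) / (2 * Real.pi) * ∫ p : ℝ × ℝ,
        charIntegrand (P.prod P) (fun z => U z.1) (fun z => V z.2) β p := by
    rw [← integral_prod_mul]
    exact hprodint
  have hone : (Real.exp (-1) : ℂ) ≠ 1 := by
    rw [Ne, Complex.ofReal_eq_one, Real.exp_eq_one_iff]; norm_num
  -- A section of the integrable product at a point with `V ω ≠ 0` is a nonzero multiple of `|U| ^
  -- β`. Such a point exists because the characteristic function of `V` at `1` is `exp (-1)`.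
  have hX : Integrable (absCpow U β) P := by
    have h1 := hφ 0 1
    rw [hNy, abs_one, Real.one_rpow] at h1
    simp only [zero_mul, zero_add, one_mul] at h1
    obtain ⟨ω, hω, hω0⟩ := exists_mem_ne_zero_of_integral_exp_ne_one hprod'.prod_left_ae
      (h1.trans_ne hone)
    exact (integrable_mul_const_iff (absCpow_ne_zero hω0).isUnit _).1 hω
  have hY' : Integrable (absCpow V (conj β)) P := by
    have h1 := hφ 1 0
    rw [hNx, abs_one, Real.one_rpow] at h1
    simp only [zero_mul, add_zero, one_mul] at h1
    obtain ⟨ω, hω, hω0⟩ := exists_mem_ne_zero_of_integral_exp_ne_one hprod'.prod_right_ae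
      (h1.trans_ne hone)
    exact (integrable_const_mul_iff (absCpow_ne_zero hω0).isUnit _).1 hω
  have hY : Integrable (absCpow V β) P := by
    refine (Complex.conjCLE.toContinuousLinearMap.integrable_comp hY').congr
      (.of_forall fun ω => ?_)
    simpa using conj_absCpow V (conj β) ω
  refine ⟨⟨hXY, hi, hXYint⟩, hX, hY, ?_⟩
  rw [complexCov_eq hX hY (by simpa only [conj_absCpow] using hXY)]
  simp only [conj_absCpow]
  rw [hXYint, hprodint', ← mul_sub, norm_mul, mul_assoc]
  refine mul_le_mul_of_nonneg_left ?_ (norm_nonneg _)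
  refine (norm_integral_sub_charIntegrand_le (κ := κ) hβ₀ hα₀ hc hi hi' fun x y => ?_).trans
    (le_of_eq (by ring))
  rw [hφ, hφ', ← Complex.ofReal_sub, Complex.norm_real, Real.norm_eq_abs]
  refine (abs_exp_neg_sub_exp_neg_le (hlow x y) (hlow' x y)).trans ?_
  exact mul_le_mul_of_nonneg_right
    (abs_integral_linear_comb_rpow_sub_le hα₀ hα₂.le hh hg hh1 hg1 x y) (Real.exp_pos _).le
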